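/- \textbf{Utility model.} Fix real numbers $b_1>b_2>b_3>\cdots>0$ (with $b_\infty=0$), $c,c_0\in\mathbb R$ and $0\le\gamma<1$. A network is a finite simple graph $g$; write $d_j$ for the degree of a node $j$, $l(j,w)$ for the graph distance, and $E(y,z)$ for the set of nodes other than $y,z$ that lie on every path joining $y$ and $z$. The utility of a node $j$ of $g$ is $$u_j(g)=d_j(b_1-c)+\sum_{w:\,l(j,w)>1}b_{l(j,w)}-\sum_{w:\,E(j,w)\ne\emptyset}\gamma\, b_{l(j,w)}+\sum_{\{y,z\}:\,j\in E(y,z)}\frac{\gamma}{|E(y,z)|}\,2b_{l(y,z)} .$$ The network $g$ is pairwise stable if $u_i(g\setminus ij)\le u_i(g)$ for every link $ij$ of $g$ and each of its ends $i$, and for every missing link $ij$, $u_i(g\cup ij)>u_i(g)$ implies $u_j(g\cup ij)<u_j(g)$. \textbf{Formation process.} From a base graph the network changes as follows. \emph{Evolution:} nodes move one at a time, in an arbitrary order; a node may create one link (with a node whose utility does not decrease by it), delete one of its links, or do nothing; it takes an option that maximizes its own immediate utility, and alters a link only if this strictly increases its utility. \emph{Entry:} whenever the network $g$ is pairwise stable,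 a new node considers entering by a single link to a node $t$ of $g$ with $u_t$ not decreasing; its utility is then its utility in the enlarged network minus the entry fee $c_0 d_t(g)$, and is $0$ if it stays out. It enters, through a $t$ that maximizes this utility, if and only if the maximum is positive. A topology is the \emph{unique resulting topology} if, for every order of moves and every choice among best responses, every evolution phase ends after finitely many moves, a new node enters at every pairwise stable network that is reached, and every pairwise stable network that is reached has this topology (so stable networks of all larger sizes arise). A \emph{$k$-star} is a network consisting of a clique on $k$ centers together with leaves, each linked to exactly one center and to nothing else, such that every center has at least one leaf and the numbers of leaves of any two centers differ by at most one. The \emph{base graph} of the $k$-star is the $k$-star on $2k$ nodes (one leaf per center). \textbf{Statement.} Let $k\ge 3$. (1) If every $k$-star (on any number of nodes) is pairwise stable, then $\gamma=0$ and $c=b_1-b_3$. (2) If $\gamma=0$, $c=b_1-b_3$ and $b_2-b_3<c_0<b_2-b_4$, then for the formation process starting from the base graph of the $k$-star, the unique resulting topology is the $k$-star. -/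

import Mathlib

namespace NetworkFormation

/-- The parameters of the utility model: `b i` is the benefit obtained from a node at (finite)
distance `i ≥ 1` in the absence of rents (`b 0` is never used), `c` is the cost of maintaining a
link, `c₀` is the network entry factor, and `γ` is the fraction of an indirect benefit that is paid
to the essential nodes. -/
structure Params where
  b : ℕ → ℝ
  c : ℝ
  c₀ : ℝ
  γ : ℝ

/-- The benefit from a node at distance `l`, with the convention `b_∞ = 0`. -/
noncomputable def Params.benefit (P : Params) (l : ℕ∞) : ℝ :=
  if l = ⊤ then 0 else P.b l.toNat

section Utility

variable {V : Type*} [Fintype V]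

open scoped Classical in
/-- `E(y, z)`: the nodes, other than `y` and `z`, that lie on every path joining `y` and `z`. -/
noncomputable def essential (g : SimpleGraph V) (y z : V) : Finset V :=
  Finset.univ.filter fun j => j ≠ y ∧ j ≠ z ∧ ∀ p : g.Walk y z, p.IsPath → j ∈ p.support

open scoped Classical in
/-- Indirect benefits of `j`: the sum of `b_{l(j,w)}` over the nodes `w` with `l(j,w) > 1`. -/
noncomputable def indirectBenefits (P : Params) (g : SimpleGraph V) (j : V) : ℝ :=
  ∑ w ∈ Finset.univ.filter (fun w => 1 < g.edist j w), P.benefit (g.edist j w)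

open scoped Classical in
/-- Intermediation rents paid by `j`: the sum of `γ b_{l(j,w)}` over the nodes `w` with
`E(j,w) ≠ ∅`. -/
noncomputable def rents (P : Params) (g : SimpleGraph V) (j : V) : ℝ :=
  ∑ w ∈ Finset.univ.filter (fun w => (essential g j w).Nonempty), P.γ * P.benefit (g.edist j w)

open scoped Classical in
/-- Bridging benefits of `j`: the sum of `(γ / |E(y,z)|) 2 b_{l(y,z)}` over the unordered pairs
`{y, z}` with `j ∈ E(y,z)`, written as half of the sum over the ordered pairs `(y, z)`
(`essential` and `edist` are symmetric, and `essential g y y` is empty). -/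
noncomputable def bridgingBenefits (P : Params) (g : SimpleGraph V) (j : V) : ℝ :=
  (1 / 2) * ∑ q ∈ (Finset.univ : Finset (V × V)).filter (fun q => j ∈ essential g q.1 q.2),
    (P.γ / ((essential g q.1 q.2).card : ℝ)) * (2 * P.benefit (g.edist q.1 q.2))

open scoped Classical in
/-- The utility of a node `j` that already belongs to the network `g`. -/
noncomputable def utility (P : Params) (g : SimpleGraph V) (j : V) : ℝ :=
  (g.degree j : ℝ) * (P.b 1 - P.c) + indirectBenefits P g j - rents P g j + bridgingBenefits P g j

/-- The network `g` with the link `ij` created. -/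
def addLink (g : SimpleGraph V) (i j : V) : SimpleGraph V := g ⊔ SimpleGraph.edge i j

/-- The network `g` with the link `ij` deleted. -/
def deleteLink (g : SimpleGraph V) (i j : V) : SimpleGraph V := g.deleteEdges {s(i, j)}

/-- Pairwise stability: nobody gains by deleting one of its links, and if one end of a missing link
would strictly gain from that link, then the other end would strictly lose. -/
def PairwiseStable (P : Params) (g : SimpleGraph V) : Prop :=
  (∀ i j, g.Adj i j → utility P (deleteLink g i j) i ≤ utility P g i) ∧
  (∀ i j, i ≠ j → ¬ g.Adj i j → utility P g i < utility P (addLink g i j) i →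
    utility P (addLink g i j) j < utility P g j)

/-- The networks to which node `i` can move from `g`: status quo, deletion of one of its links, or
creation of a link with a node that accepts it, that is, whose utility does not decrease. -/
def CanMove (P : Params) (i : V) (g g' : SimpleGraph V) : Prop :=
  g' = g ∨
  (∃ j, g.Adj i j ∧ g' = deleteLink g i j) ∨
  (∃ j, i ≠ j ∧ ¬ g.Adj i j ∧ g' = addLink g i j ∧ utility P g j ≤ utility P g' j)

/-- One effective move of the evolution phase: some node `i`, given the chance to move, alters a
link as a myopic best response, and it does so only if this strictly increases its utility. -/
def EvolutionStep (P : Params) (g g' : SimpleGraph V) : Prop :=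
  ∃ i, CanMove P i g g' ∧ (∀ g'', CanMove P i g g'' → utility P g'' i ≤ utility P g' i) ∧
    utility P g i < utility P g' i

end Utility

section Formation

/-- The network on `n + 1` nodes in which the new node `Fin.last n` has created its first link, with
the node `t` of the `n`-node network `g`. -/
def attach {n : ℕ} (g : SimpleGraph (Fin n)) (t : Fin n) : SimpleGraph (Fin (n + 1)) :=
  g.map Fin.castSuccEmb ⊔ SimpleGraph.edge t.castSucc (Fin.last n)

open scoped Classical in
/-- The utility of the newly entering node when it enters `g` through its node `t`; the entry fee is
`c₀` times the degree of `t` in the network `g` that is being entered. -/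
noncomputable def entrantUtility (P : Params) {n : ℕ} (g : SimpleGraph (Fin n)) (t : Fin n) : ℝ :=
  -P.c₀ * (g.degree t : ℝ) + utility P (attach g t) (Fin.last n)

/-- Node `t` accepts the link proposed by the newly entering node: its utility does not decrease. -/
def Accepts (P : Params) {n : ℕ} (g : SimpleGraph (Fin n)) (t : Fin n) : Prop :=
  utility P g t ≤ utility P (attach g t) t.castSucc

/-- Entering through `t` is a myopic best response of the newly entering node: `t` accepts,
entering is strictly better than staying out (utility `0`), and no other node that would accept
gives the entrant a higher utility. -/
def IsEntryChoice (P : Params) {n : ℕ} (g : SimpleGraph (Fin n)) (t : Fin n) : Prop :=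
  Accepts P g t ∧ 0 < entrantUtility P g t ∧
    ∀ t', Accepts P g t' → entrantUtility P g t' ≤ entrantUtility P g t

/-- The networks that can occur in the recursive formation process with base graph `g₀`, for some
order of the moves and some choice among best responses: a network evolves by best-response moves,
and whenever it is pairwise stable a new node may enter. -/
inductive Reached (P : Params) {n₀ : ℕ} (g₀ : SimpleGraph (Fin n₀)) :
    (n : ℕ) → SimpleGraph (Fin n) → Prop
  | base : Reached P g₀ n₀ g₀
  | evolve {n : ℕ} {g g' : SimpleGraph (Fin n)} :
      Reached P g₀ n g → EvolutionStep P g g' → Reached P g₀ n g'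
  | enter {n : ℕ} {g : SimpleGraph (Fin n)} {t : Fin n} :
      Reached P g₀ n g → PairwiseStable P g → IsEntryChoice P g t →
        Reached P g₀ (n + 1) (attach g t)

/-- `T` is the unique resulting topology of the process with base graph `g₀`: whatever the order of
moves and the choices among best responses,
* every stable network of the process has topology `T`;
* every evolution phase ends in a stable network (no infinite sequence of moves is possible);
* at every stable network, a newly considered node does enter;
and hence stable networks of all sizes `n ≥ n₀` arise. -/
def UniqueResultingTopology (P : Params) {n₀ : ℕ} (g₀ : SimpleGraph (Fin n₀))
    (T : ∀ n : ℕ, SimpleGraph (Fin n) → Prop) : Prop :=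
  (∀ (n : ℕ) (g : SimpleGraph (Fin n)), Reached P g₀ n g → PairwiseStable P g → T n g) ∧
  (∀ (n : ℕ) (g : SimpleGraph (Fin n)), Reached P g₀ n g →
    ¬ ∃ s : ℕ → SimpleGraph (Fin n), s 0 = g ∧ ∀ i, EvolutionStep P (s i) (s (i + 1))) ∧
  (∀ (n : ℕ) (g : SimpleGraph (Fin n)), Reached P g₀ n g → PairwiseStable P g →
    ∃ t, IsEntryChoice P g t) ∧
  (∀ n : ℕ, n₀ ≤ n → ∃ g : SimpleGraph (Fin n), Reached P g₀ n g ∧ PairwiseStable P g)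

end Formation

section KStar

open scoped Classical in
/-- The number of nodes outside `C` that are linked to `p`. -/
noncomputable def leafCount {V : Type*} [Fintype V] (g : SimpleGraph V) (C : Finset V) (p : V) : ℕ :=
  (Finset.univ.filter fun x => x ∉ C ∧ g.Adj p x).card

/-- `g` is a `k`-star: a clique on a set `C` of `k` centers, every other node is a leaf whose only
link is with a center, every center has at least one leaf, and the numbers of leaves of any two
centers differ by at most one. -/
def IsKStar {V : Type*} [Fintype V] (k : ℕ) (g : SimpleGraph V) : Prop :=
  ∃ C : Finset V, C.card = k ∧ g.IsClique (C : Set V) ∧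
    (∀ x, x ∉ C → ∃ p ∈ C, ∀ y, g.Adj x y ↔ y = p) ∧
    (∀ p ∈ C, 1 ≤ leafCount g C p) ∧
    (∀ p ∈ C, ∀ q ∈ C, leafCount g C p ≤ leafCount g C q + 1)

/-- The base graph of the `k`-star: a clique on the centers `0, …, k - 1`, and for every center `i`
one leaf `k + i`. -/
def kStarBase (k : ℕ) : SimpleGraph (Fin (2 * k)) where
  Adj i j := i ≠ j ∧ ((i.val < k ∧ j.val < k) ∨ j.val = k + i.val ∨ i.val = k + j.val)
  symm := ⟨fun _ _ h => ⟨h.1.symm, h.2.elim (fun h => Or.inl h.symm) (fun h => Or.inr h.symm)⟩⟩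
  loopless := ⟨fun _ h => h.1 rfl⟩

end KStar

end NetworkFormation

/-!
Without rents the utility of a node is a sum over the other nodes of a value depending only on the
distance: a link is worth `b₁ - c`, a node at distance `l ≥ 2` is worth `b_l`.

Sufficiency. If `c = b₁ - b₃`, a link is worth `b₃`, just like a node at distance three. In a
`k`-star all distances are at most three, so a change of the network can raise the value of a node
only by bringing it to distance exactly two (`value_le_value`). A new link between leaves never does
this; a new link of a center replaces a value `b₂` by `b₃`, so the center loses; and deleting a link
between centers brings one center to distance two, but its leaves to distance three. Hence `k`-stars
are pairwise stable (`IsKStarOn.pairwiseStable`). An entrant through a center of degree `d` in a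
network of `n` nodes gets `n b₃ + d (b₂ - b₃ - c₀)`, which decreases in `d`. An entrant through a
leaf of `p` gets at most `n b₄ + deg p (b₃ - b₄) + (b₂ - b₄) - c₀`. With `b₄ < b₂ - c₀ < b₃` the
best center beats every leaf, because a balanced star on at least three centers has
`deg p + deg q ≤ n` for `q` a center of least degree. So a newcomer joins a center with the fewest
leaves (`IsKStarOn.isEntryChoice_iff`), and the network is again a `k`-star.

Necessity. A new link weakly raises the bridging benefits of both ends, since every path through the
link contains both of them. If `γ > 0` and a leaf `x` of `p` links to another center `q`, the gain
of `x` from shorter distances and the gain of `q` from the pairs of `x` with its leaves both grow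
linearly in the number of leaves of `q`, so large `k`-stars are unstable (`γ_eq_zero_of_stable`).
With `γ = 0`, leaves of different centers do not link only if `b₁ - c ≤ b₃`, and in the base graph
centers do not delete their links only if `b₁ - c ≥ b₃`.
-/

namespace NetworkFormation

/-! ### Benefits and distances -/

/-- Benefits are positive and strictly decreasing in the distance. -/
structure Params.Decaying (P : Params) : Prop where
  pos : ∀ i : ℕ, 1 ≤ i → 0 < P.b i
  step : ∀ i : ℕ, 1 ≤ i → P.b (i + 1) < P.b i

theorem Params.Decaying.b_antitone {P : Params} (hP : P.Decaying) {i j : ℕ} (hi : 1 ≤ i)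
    (hij : i ≤ j) : P.b j ≤ P.b i := by
  induction j, hij using Nat.le_induction with
  | base => exact le_rfl
  | succ j hj ih => exact (hP.step j (hi.trans hj)).le.trans ih

theorem benefit_coe (P : Params) (l : ℕ) : P.benefit l = P.b l := by
  simp [Params.benefit]

theorem Params.Decaying.benefit_nonneg {P : Params} (hP : P.Decaying) {l : ℕ∞} (hl : 1 ≤ l) :
    0 ≤ P.benefit l := by
  induction l using ENat.recTopCoe with
  | top => simp [Params.benefit]
  | coe l => rw [benefit_coe]; exact (hP.pos l (by exact_mod_cast hl)).le

theorem Params.Decaying.benefit_antitone {P : Params} (hP : P.Decaying) {l l' : ℕ∞} (hl : 1 ≤ l)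
    (hll : l ≤ l') : P.benefit l' ≤ P.benefit l := by
  induction l' using ENat.recTopCoe with
  | top => simpa [Params.benefit] using hP.benefit_nonneg hl
  | coe l' =>
    lift l to ℕ using ne_top_of_le_ne_top (ENat.natCast_ne_top l') hll
    rw [benefit_coe, benefit_coe]
    exact hP.b_antitone (by exact_mod_cast hl) (by exact_mod_cast hll)

section Distance

variable {V : Type*} {g : SimpleGraph V} {u v x y : V}

theorem one_le_edist (h : u ≠ v) : 1 ≤ g.edist u v :=
  Order.one_le_iff_pos.mpr (SimpleGraph.edist_pos_of_ne h)

theorem one_lt_edist_iff : 1 < g.edist u v ↔ u ≠ v ∧ ¬ g.Adj u v := by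
  rw [← not_le, SimpleGraph.edist_le_one_iff_adj_or_eq]; tauto

theorem edist_le_three (h₁ : g.Adj u x) (h₂ : g.Adj x y) (h₃ : g.Adj y v) : g.edist u v ≤ 3 :=
  SimpleGraph.edist_le (.cons h₁ (.cons h₂ (.cons h₃ .nil)))

theorem three_le_edist (hne : u ≠ v) (hadj : ¬ g.Adj u v) (h : ∀ x, g.Adj u x → ¬ g.Adj x v) :
    3 ≤ g.edist u v := by
  have : 2 < g.edist u v := by
    rw [SimpleGraph.two_lt_edist_iff]
    refine ⟨hne, hadj, ?_⟩
    ext x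
    simpa [SimpleGraph.mem_commonNeighbors, SimpleGraph.adj_comm] using h x
  exact Order.add_one_le_of_lt this

/-- If all neighbours of `u` are at distance at least `n` from `v`, then `u` is at distance at
least `n + 1`. -/
theorem succ_le_edist (hne : u ≠ v) {n : ℕ} (h : ∀ x, g.Adj u x → (n : ℕ∞) ≤ g.edist x v) :
    ((n + 1 : ℕ) : ℕ∞) ≤ g.edist u v := by
  refine le_iInf fun p => ?_
  cases p with
  | nil => exact absurd rfl hne
  | cons hux p =>
    have := (h _ hux).trans (SimpleGraph.edist_le p)
    rw [SimpleGraph.Walk.length_cons]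
    exact_mod_cast Nat.succ_le_succ (by exact_mod_cast this)

end Distance

/-! ### The value of a distance in the absence of rents -/

/-- What a node at distance `l` contributes to the utility when there are no rents: a link
contributes `b₁ - c`, a node at distance `l ≥ 2` contributes `b_l`, the node itself nothing. -/
noncomputable def Params.value (P : Params) (l : ℕ∞) : ℝ :=
  if l = 0 then 0 else if l = 1 then P.b 1 - P.c else P.benefit l

section Value

variable {V : Type*} {P : Params} {g g' : SimpleGraph V} {u v x y : V}

theorem value_adj (h : g.Adj u v) : P.value (g.edist u v) = P.b 1 - P.c := by
  simp [Params.value, SimpleGraph.edist_eq_one_iff_adj.mpr h]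

theorem value_self : P.value (g.edist u u) = 0 := by simp [Params.value]

theorem value_of_not_adj (hne : u ≠ v) (h : ¬ g.Adj u v) :
    P.value (g.edist u v) = P.benefit (g.edist u v) := by
  simp [Params.value, hne, h]

theorem value_of_adj_of_adj (hne : u ≠ v) (h : ¬ g.Adj u v) (h₁ : g.Adj u x) (h₂ : g.Adj x v) :
    P.value (g.edist u v) = P.b 2 := by
  have : g.edist u v = (2 : ℕ) := by
    rw [Nat.cast_ofNat, SimpleGraph.edist_eq_two_iff]
    exact ⟨hne, h, x, by simpa [SimpleGraph.mem_commonNeighbors] using ⟨h₁, h₂.symm⟩⟩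
  rw [value_of_not_adj hne h, this, benefit_coe]

theorem value_le_b (hP : P.Decaying) {n : ℕ} (hn : 2 ≤ n) (h : (n : ℕ∞) ≤ g.edist u v) :
    P.value (g.edist u v) ≤ P.b n := by
  have h2 : (2 : ℕ∞) ≤ g.edist u v := le_trans (by exact_mod_cast hn) h
  have h1 : (1 : ℕ∞) < g.edist u v := lt_of_lt_of_le (by norm_num) h2
  rw [one_lt_edist_iff] at h1
  rw [value_of_not_adj h1.1 h1.2, ← benefit_coe]
  exact hP.benefit_antitone (by exact_mod_cast (by omega : 1 ≤ n)) h

/-- When a link is worth `b₃`, only nodes at distance exactly two are worth more than `b₃`. -/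
theorem value_le_b_three (hP : P.Decaying) (hc : P.c = P.b 1 - P.b 3) (hne : u ≠ v)
    (h : ∀ x, g.Adj u x → ¬ g.Adj x v) : P.value (g.edist u v) ≤ P.b 3 := by
  by_cases hadj : g.Adj u v
  · rw [value_adj hadj]; linarith
  · exact value_le_b hP (by norm_num) (three_le_edist hne hadj h)

theorem b_three_le_value (hP : P.Decaying) (hc : P.c = P.b 1 - P.b 3) (hne : u ≠ v)
    (h : g.edist u v ≤ 3) : P.b 3 ≤ P.value (g.edist u v) := by
  by_cases hadj : g.Adj u v
  · rw [value_adj hadj]; linarith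
  · rw [value_of_not_adj hne hadj, ← benefit_coe]
    exact hP.benefit_antitone (one_le_edist hne) h

theorem value_le_b_two (hP : P.Decaying) (hc : P.c = P.b 1 - P.b 3) (hne : u ≠ v) :
    P.value (g.edist u v) ≤ P.b 2 := by
  by_cases hadj : g.Adj u v
  · rw [value_adj hadj]; linarith [hP.step 2 (by norm_num)]
  · exact value_le_b hP (by norm_num)
      (by exact_mod_cast Order.add_one_le_of_lt (one_lt_edist_iff.mpr ⟨hne, hadj⟩))

theorem value_nonneg (hP : P.Decaying) (hc : P.c = P.b 1 - P.b 3) :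
    0 ≤ P.value (g.edist u v) := by
  rcases eq_or_ne u v with rfl | hne
  · rw [value_self]
  by_cases hadj : g.Adj u v
  · rw [value_adj hadj]; linarith [hP.pos 3 (by norm_num)]
  · rw [value_of_not_adj hne hadj]
    exact hP.benefit_nonneg (one_le_edist hne)

/-- When a link is worth `b₃`, passing from `g` to `g'` can raise the value of a node within
distance three only by bringing it to distance exactly two. -/
theorem value_le_value (hP : P.Decaying) (hc : P.c = P.b 1 - P.b 3) (h3 : g.edist u v ≤ 3)
    (h : ∀ x, u ≠ v → ¬ g'.Adj u v → g'.Adj u x → g'.Adj x v →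
      ¬ g.Adj u v ∧ ∃ y, g.Adj u y ∧ g.Adj y v) :
    P.value (g'.edist u v) ≤ P.value (g.edist u v) := by
  rcases eq_or_ne u v with rfl | hne
  · rw [value_self, value_self]
  by_cases h2 : ¬ g'.Adj u v ∧ ∃ x, g'.Adj u x ∧ g'.Adj x v
  · obtain ⟨hadj, x, h₁, h₂⟩ := h2
    obtain ⟨hn, y, h₃, h₄⟩ := h x hne hadj h₁ h₂
    rw [value_of_adj_of_adj hne hadj h₁ h₂, value_of_adj_of_adj hne hn h₃ h₄]
  · refine le_trans ?_ (b_three_le_value hP hc hne h3)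
    by_cases hadj : g'.Adj u v
    · rw [value_adj hadj]; linarith
    · exact value_le_b_three hP hc hne fun x h₁ h₂ => h2 ⟨hadj, x, h₁, h₂⟩

end Value

/-! ### Utility as a sum over nodes -/

section Utility

variable {V : Type*} [Fintype V]

theorem mem_essential {g : SimpleGraph V} {y z j : V} : j ∈ essential g y z ↔
    j ≠ y ∧ j ≠ z ∧ ∀ p : g.Walk y z, p.IsPath → j ∈ p.support := by
  simp [essential]

theorem essential_self (g : SimpleGraph V) (y : V) : essential g y y = ∅ := by
  ext j
  simp only [mem_essential, Finset.notMem_empty, iff_false]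
  rintro ⟨h, -, hp⟩
  exact h (by simpa using hp .nil .nil)

theorem essential_of_adj {g : SimpleGraph V} {y z : V} (h : g.Adj y z) : essential g y z = ∅ := by
  ext j
  simp only [mem_essential, Finset.notMem_empty, iff_false]
  rintro ⟨hy, hz, hp⟩
  have := hp h.toWalk (SimpleGraph.Walk.IsPath.of_adj h)
  simp [SimpleGraph.Adj.toWalk] at this
  tauto

open scoped Classical in
/-- The contribution of `w` to the utility of `j`, bridging benefits excepted. -/
noncomputable def netValue (P : Params) (g : SimpleGraph V) (j w : V) : ℝ :=
  (if g.Adj j w then P.b 1 - P.c else 0) + (if 1 < g.edist j w then P.benefit (g.edist j w) else 0)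
    - (if (essential g j w).Nonempty then P.γ * P.benefit (g.edist j w) else 0)

theorem utility_eq_sum_netValue (P : Params) (g : SimpleGraph V) (j : V) :
    utility P g j = ∑ w, netValue P g j w + bridgingBenefits P g j := by
  classical
  simp only [utility, indirectBenefits, rents, netValue, Finset.sum_sub_distrib,
    Finset.sum_add_distrib, Finset.sum_filter]
  congr 3
  rw [← Finset.sum_filter, Finset.sum_const, nsmul_eq_mul,
    ← SimpleGraph.card_neighborFinset_eq_degree, SimpleGraph.neighborFinset_eq_filter]

theorem utility_eq_sum_value {P : Params} (hγ : P.γ = 0) (g : SimpleGraph V) (j : V) :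
    utility P g j = ∑ w, P.value (g.edist j w) := by
  rw [utility_eq_sum_netValue]
  have : bridgingBenefits P g j = 0 := by simp [bridgingBenefits, hγ]
  rw [this, add_zero]
  refine Finset.sum_congr rfl fun w _ => ?_
  rcases eq_or_ne j w with rfl | hne
  · simp [netValue, Params.value, hγ]
  by_cases h : g.Adj j w
  · rw [value_adj h]
    simp [netValue, h, hγ, SimpleGraph.edist_eq_one_iff_adj.mpr h]
  · rw [value_of_not_adj hne h]
    simp [netValue, h, hγ, one_lt_edist_iff, hne]

end Utility

/-! ### Creating and deleting a link -/

section AddLink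

variable {V : Type*} {g : SimpleGraph V} {i j u v : V}

theorem addLink_adj : (addLink g i j).Adj u v ↔
    g.Adj u v ∨ ((u = i ∧ v = j ∨ u = j ∧ v = i) ∧ u ≠ v) := by
  simp [addLink, SimpleGraph.edge_adj]

theorem le_addLink : g ≤ addLink g i j := le_sup_left

theorem addLink_comm (g : SimpleGraph V) (i j : V) : addLink g i j = addLink g j i := by
  simp [addLink, SimpleGraph.edge_comm]

theorem addLink_adj_self (h : i ≠ j) : (addLink g i j).Adj i j :=
  addLink_adj.mpr (.inr ⟨.inl ⟨rfl, rfl⟩, h⟩)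

theorem deleteLink_adj {u v : V} : (deleteLink g i j).Adj u v ↔ g.Adj u v ∧ s(u, v) ≠ s(i, j) := by
  simp [deleteLink]

theorem benefit_edist_le_addLink {P : Params} (hP : P.Decaying) (u v : V) :
    P.benefit (g.edist u v) ≤ P.benefit ((addLink g i j).edist u v) := by
  rcases eq_or_ne u v with rfl | hne
  · simp
  · exact hP.benefit_antitone (one_le_edist hne) (SimpleGraph.edist_anti le_addLink)

variable [Fintype V]

theorem essential_mono {g' : SimpleGraph V} (h : g ≤ g') (y z : V) :
    essential g' y z ⊆ essential g y z := by
  intro w hw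
  rw [mem_essential] at hw ⊢
  refine ⟨hw.1, hw.2.1, fun p hp => ?_⟩
  simpa using hw.2.2 (p.mapLe h) (hp.mapLe h)

/-- Every path through a new link passes through both of its ends, so a new link costs neither of
its ends its essential position. -/
theorem mem_essential_addLink {y z : V} (h : i ∈ essential g y z) :
    i ∈ essential (addLink g i j) y z := by
  rw [mem_essential] at h ⊢
  refine ⟨h.1, h.2.1, fun p hp => ?_⟩
  by_contra hi
  have hedges : ∀ e ∈ p.edges, e ∈ g.edgeSet := by
    intro e he
    induction e with
    | h a b =>
      have ha := p.fst_mem_support_of_mem_edges he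
      have hb := p.snd_mem_support_of_mem_edges he
      have hab := addLink_adj.mp (p.adj_of_mem_edges he)
      rcases hab with hab | ⟨⟨rfl, -⟩ | ⟨-, rfl⟩, -⟩
      · exact hab
      · exact absurd ha hi
      · exact absurd hb hi
  exact hi (by simpa using h.2.2 (p.transfer g hedges) (hp.transfer hedges))

/-- The summand of `bridgingBenefits` for the ordered pair `(y, z)`. -/
noncomputable def bridgingTerm (P : Params) (g : SimpleGraph V) (y z : V) : ℝ :=
  (P.γ / ((essential g y z).card : ℝ)) * (2 * P.benefit (g.edist y z))

theorem bridgingTerm_nonneg {P : Params} (hP : P.Decaying) (hγ : 0 ≤ P.γ) {y z : V}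
    (h : i ∈ essential g y z) : 0 ≤ bridgingTerm P g y z := by
  have hne : y ≠ z := by rintro rfl; simp [essential_self] at h
  have := hP.benefit_nonneg (one_le_edist (g := g) hne)
  unfold bridgingTerm
  positivity

theorem bridgingTerm_le {P : Params} (hP : P.Decaying) (hγ : 0 ≤ P.γ) {y z : V}
    (h : i ∈ essential g y z) : bridgingTerm P g y z ≤ bridgingTerm P (addLink g i j) y z := by
  have hne : y ≠ z := by rintro rfl; simp [essential_self] at h
  have hpos : 0 < (essential (addLink g i j) y z).card :=
    Finset.card_pos.mpr ⟨i, mem_essential_addLink h⟩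
  have hcard := Finset.card_le_card (essential_mono (le_addLink (g := g) (i := i) (j := j)) y z)
  have hb := hP.benefit_antitone (one_le_edist (g := addLink g i j) hne)
    (SimpleGraph.edist_anti (le_addLink (g := g) (i := i) (j := j)))
  have hb0 := hP.benefit_nonneg (one_le_edist (g := g) hne)
  unfold bridgingTerm
  gcongr

/-- Creating a link does not lower the bridging benefits of its ends. The gain is at least half of
the gain on the pairs `(x, y)`, `y ∈ S`, for any fixed `x`. -/
theorem bridgingBenefits_addLink {P : Params} (hP : P.Decaying) (hγ : 0 ≤ P.γ) (i j x : V)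
    (S : Finset V) (hS : ∀ y ∈ S, i ∈ essential g x y) :
    bridgingBenefits P g i +
        1 / 2 * ∑ y ∈ S, (bridgingTerm P (addLink g i j) x y - bridgingTerm P g x y) ≤
      bridgingBenefits P (addLink g i j) i := by
  classical
  set A := (Finset.univ : Finset (V × V)).filter fun q => i ∈ essential g q.1 q.2
  set B := (Finset.univ : Finset (V × V)).filter fun q => i ∈ essential (addLink g i j) q.1 q.2
  have hAB : A ⊆ B := fun q hq => by
    simp only [A, B, Finset.mem_filter, Finset.mem_univ, true_and] at hq ⊢
    exact mem_essential_addLink hq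
  have hAB' : ∑ q ∈ A, bridgingTerm P (addLink g i j) q.1 q.2 ≤
      ∑ q ∈ B, bridgingTerm P (addLink g i j) q.1 q.2 :=
    Finset.sum_le_sum_of_subset_of_nonneg hAB fun q hq _ =>
      bridgingTerm_nonneg hP hγ (Finset.mem_filter.mp hq).2
  have hSA : S.map ⟨fun y => (x, y), Prod.mk_right_injective x⟩ ⊆ A := fun q hq => by
    obtain ⟨y, hy, rfl⟩ := Finset.mem_map.mp hq
    simpa [A] using hS y hy
  have hsum := Finset.sum_le_sum_of_subset_of_nonneg
    (f := fun q : V × V => bridgingTerm P (addLink g i j) q.1 q.2 - bridgingTerm P g q.1 q.2) hSA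
    fun q hq _ => sub_nonneg.mpr (bridgingTerm_le hP hγ (Finset.mem_filter.mp hq).2)
  rw [Finset.sum_map, Finset.sum_sub_distrib (s := A)] at hsum
  simp only [Function.Embedding.coeFn_mk] at hsum
  have e₁ : bridgingBenefits P g i = 1 / 2 * ∑ q ∈ A, bridgingTerm P g q.1 q.2 := rfl
  have e₂ : bridgingBenefits P (addLink g i j) i =
    1 / 2 * ∑ q ∈ B, bridgingTerm P (addLink g i j) q.1 q.2 := rfl
  rw [e₁, e₂]
  linarith

theorem netValue_addLink_self {P : Params} (hP : P.Decaying) (hγ : 0 ≤ P.γ) (hij : i ≠ j)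
    (hadj : ¬ g.Adj i j) :
    netValue P g i j + (P.b 1 - P.c - P.benefit (g.edist i j)) ≤
      netValue P (addLink g i j) i j := by
  have h := addLink_adj_self (g := g) hij
  have hB := mul_nonneg hγ (hP.benefit_nonneg (one_le_edist (g := g) hij))
  have hl : ¬ 1 < (addLink g i j).edist i j := by simp [one_lt_edist_iff, h]
  have hl' : 1 < g.edist i j := one_lt_edist_iff.mpr ⟨hij, hadj⟩
  simp only [netValue, h, hadj, hl, hl', essential_of_adj h, Finset.not_nonempty_empty, if_true,
    if_false]
  split_ifs <;> linarith

theorem netValue_addLink_of_ne {P : Params} (hP : P.Decaying) (hγ : 0 ≤ P.γ) {w : V} (hw : w ≠ j) :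
    netValue P g i w +
        (1 - P.γ) * (P.benefit ((addLink g i j).edist i w) - P.benefit (g.edist i w)) ≤
      netValue P (addLink g i j) i w := by
  rcases eq_or_ne i w with rfl | hne
  · simp [netValue, essential_self]
  have hadj : (addLink g i j).Adj i w ↔ g.Adj i w := by
    rw [addLink_adj]
    constructor
    · rintro (h | ⟨⟨-, h⟩ | ⟨-, h⟩, -⟩)
      exacts [h, absurd h hw, absurd h.symm hne]
    · exact .inl
  have hB := benefit_edist_le_addLink (g := g) (i := i) (j := j) hP i w
  have hBpos := mul_nonneg hγ (hP.benefit_nonneg (one_le_edist (g := g) hne))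
  by_cases h : g.Adj i w
  · have h' := hadj.mpr h
    have e := SimpleGraph.edist_eq_one_iff_adj.mpr h
    have e' := SimpleGraph.edist_eq_one_iff_adj.mpr h'
    simp [netValue, h, h', e, e', essential_of_adj]
  · have h' := hadj.not.mpr h
    have hl : 1 < g.edist i w := one_lt_edist_iff.mpr ⟨hne, h⟩
    have hl' : 1 < (addLink g i j).edist i w := one_lt_edist_iff.mpr ⟨hne, h'⟩
    simp only [netValue, h, h', hl, hl', if_true, if_false]
    by_cases hE : (essential (addLink g i j) i w).Nonempty
    · rw [if_pos hE, if_pos (hE.mono (essential_mono le_addLink i w))]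
      linarith
    · rw [if_neg hE]
      have := mul_nonneg hγ (sub_nonneg.mpr hB)
      split_ifs <;> linarith

/-- A lower bound for the change of the utility of an end of a new link: rents take at most the
fraction `γ` of the benefits from shorter distances. -/
theorem utility_addLink_ge {P : Params} (hP : P.Decaying) (hγ : 0 ≤ P.γ) (hγ' : P.γ ≤ 1)
    (hij : i ≠ j) (hadj : ¬ g.Adj i j) (T : Finset V) (hT : j ∉ T) :
    utility P g i + (P.b 1 - P.c - P.benefit (g.edist i j)) +
        (1 - P.γ) * ∑ w ∈ T,
          (P.benefit ((addLink g i j).edist i w) - P.benefit (g.edist i w)) +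
        (bridgingBenefits P (addLink g i j) i - bridgingBenefits P g i) ≤
      utility P (addLink g i j) i := by
  classical
  have hsum : ∑ w ∈ T, (1 - P.γ) *
      (P.benefit ((addLink g i j).edist i w) - P.benefit (g.edist i w)) ≤
      ∑ w ∈ Finset.univ.erase j, (netValue P (addLink g i j) i w - netValue P g i w) := by
    refine (Finset.sum_le_sum_of_subset_of_nonneg (t := Finset.univ.erase j)
      (fun w hw => by simpa using fun h : w = j => hT (h ▸ hw)) fun w _ _ =>
        mul_nonneg (sub_nonneg.mpr hγ')
          (sub_nonneg.mpr (benefit_edist_le_addLink hP i w))).trans ?_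
    exact Finset.sum_le_sum fun w hw => by
      have := netValue_addLink_of_ne (g := g) (i := i) hP hγ (Finset.ne_of_mem_erase hw)
      linarith
  have hj := netValue_addLink_self hP hγ hij hadj
  rw [Finset.sum_sub_distrib] at hsum
  rw [utility_eq_sum_netValue, utility_eq_sum_netValue,
    ← Finset.add_sum_erase _ (netValue P g i) (Finset.mem_univ j),
    ← Finset.add_sum_erase _ (netValue P (addLink g i j) i) (Finset.mem_univ j), Finset.mul_sum]
  linarith

end AddLink

/-! ### Combinatorics of k-stars -/

/-- `g` is a `k`-star with set of centers `C`. -/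
structure IsKStarOn {V : Type*} [Fintype V] (k : ℕ) (g : SimpleGraph V) (C : Finset V) : Prop where
  card : C.card = k
  clique : g.IsClique (C : Set V)
  leaf : ∀ x, x ∉ C → ∃ p ∈ C, ∀ y, g.Adj x y ↔ y = p
  one_le : ∀ p ∈ C, 1 ≤ leafCount g C p
  balanced : ∀ p ∈ C, ∀ q ∈ C, leafCount g C p ≤ leafCount g C q + 1

theorem isKStar_iff {V : Type*} [Fintype V] {k : ℕ} {g : SimpleGraph V} :
    IsKStar k g ↔ ∃ C, IsKStarOn k g C :=
  ⟨fun ⟨C, h₁, h₂, h₃, h₄, h₅⟩ => ⟨C, h₁, h₂, h₃, h₄, h₅⟩,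
    fun ⟨C, h⟩ => ⟨C, h.card, h.clique, h.leaf, h.one_le, h.balanced⟩⟩

namespace IsKStarOn

variable {V : Type*} [Fintype V] {k : ℕ} {g : SimpleGraph V} {C : Finset V} {i j p q x y : V}

theorem adj_center (h : IsKStarOn k g C) (hp : p ∈ C) (hq : q ∈ C) (hne : p ≠ q) : g.Adj p q :=
  h.clique hp hq hne

theorem mem_of_adj_leaf (h : IsKStarOn k g C) (hx : x ∉ C) (hxp : g.Adj x p) : p ∈ C := by
  obtain ⟨r, hr, hxr⟩ := h.leaf x hx
  rwa [(hxr p).mp hxp]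

theorem eq_of_adj_leaf (h : IsKStarOn k g C) (hx : x ∉ C) (hxp : g.Adj x p) (hxq : g.Adj x q) :
    p = q := by
  obtain ⟨r, hr, hxr⟩ := h.leaf x hx
  rw [(hxr p).mp hxp, (hxr q).mp hxq]

theorem exists_center (h : IsKStarOn k g C) (hx : x ∉ C) : ∃ p ∈ C, g.Adj x p := by
  obtain ⟨r, hr, hxr⟩ := h.leaf x hx
  exact ⟨r, hr, (hxr r).mpr rfl⟩

theorem exists_leaf (h : IsKStarOn k g C) (hp : p ∈ C) : ∃ x, x ∉ C ∧ g.Adj p x := by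
  have := h.one_le p hp
  rw [leafCount, Nat.one_le_iff_ne_zero, Finset.card_ne_zero] at this
  obtain ⟨x, hx⟩ := this
  exact ⟨x, by simpa using hx⟩

theorem exists_adj_adj (h : IsKStarOn k g C) (hp : p ∈ C) (hne : p ≠ x) (hpx : ¬ g.Adj p x) :
    ∃ q, g.Adj p q ∧ g.Adj q x := by
  have hx : x ∉ C := fun hx => hpx (h.adj_center hp hx hne)
  obtain ⟨q, hq, hxq⟩ := h.exists_center hx
  exact ⟨q, h.adj_center hp hq fun e => hpx (e ▸ hxq.symm), hxq.symm⟩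

theorem exists_edist_le_one (h : IsKStarOn k g C) (x : V) : ∃ p ∈ C, g.edist x p ≤ 1 := by
  by_cases hx : x ∈ C
  · exact ⟨x, hx, by simp⟩
  · obtain ⟨p, hp, hxp⟩ := h.exists_center hx
    exact ⟨p, hp, SimpleGraph.edist_le_one_iff_adj_or_eq.mpr (.inl hxp)⟩

theorem edist_le_two (h : IsKStarOn k g C) (hp : p ∈ C) (x : V) : g.edist p x ≤ 2 := by
  obtain ⟨q, hq, hxq⟩ := h.exists_edist_le_one x
  have hpq : g.edist p q ≤ 1 := SimpleGraph.edist_le_one_iff_adj_or_eq.mpr <| by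
    rcases eq_or_ne p q with e | e
    exacts [.inr e, .inl (h.adj_center hp hq e)]
  rw [SimpleGraph.edist_comm] at hxq
  exact (SimpleGraph.edist_triangle (v := q)).trans
    ((add_le_add hpq hxq).trans (by norm_num))

theorem edist_le_three (h : IsKStarOn k g C) (x y : V) : g.edist x y ≤ 3 := by
  obtain ⟨p, hp, hxp⟩ := h.exists_edist_le_one x
  exact (SimpleGraph.edist_triangle (v := p)).trans
    ((add_le_add hxp (h.edist_le_two hp y)).trans (by norm_num))

theorem three_le_edist_leaf_leaf (h : IsKStarOn k g C) (hx : x ∉ C) (hy : y ∉ C)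
    (hp : g.Adj x p) (hq : g.Adj y q) (hpq : p ≠ q) : 3 ≤ g.edist x y := by
  refine three_le_edist ?_ (fun e => hy (h.mem_of_adj_leaf hx e)) fun r h₁ h₂ => hpq ?_
  · rintro rfl
    exact hpq (h.eq_of_adj_leaf hx hp hq)
  · rw [h.eq_of_adj_leaf hx hp h₁, h.eq_of_adj_leaf hy hq h₂.symm]

/-! ### Stability of k-stars -/

variable {P : Params}

theorem utility_addLink_center_lt (h : IsKStarOn k g C) (hP : P.Decaying) (hγ : P.γ = 0)
    (hc : P.c = P.b 1 - P.b 3) (hi : i ∈ C) (hij : i ≠ j) (hadj : ¬ g.Adj i j) :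
    utility P (addLink g i j) i < utility P g i := by
  rw [utility_eq_sum_value hγ, utility_eq_sum_value hγ]
  refine Finset.sum_lt_sum (fun w _ => ?_) ⟨j, Finset.mem_univ j, ?_⟩
  · refine value_le_value hP hc (h.edist_le_three i w) fun x hne hn _ _ => ?_
    have hn' : ¬ g.Adj i w := fun e => hn (le_addLink e)
    exact ⟨hn', h.exists_adj_adj hi hne hn'⟩
  · obtain ⟨q, h₁, h₂⟩ := h.exists_adj_adj hi hij hadj
    rw [value_adj (addLink_adj_self hij), value_of_adj_of_adj hij hadj h₁ h₂]
    linarith [hP.step 2 (by norm_num)]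

theorem utility_addLink_leaf_le (h : IsKStarOn k g C) (hP : P.Decaying) (hγ : P.γ = 0)
    (hc : P.c = P.b 1 - P.b 3) (hi : i ∉ C) (hj : j ∉ C) :
    utility P (addLink g i j) i ≤ utility P g i := by
  rw [utility_eq_sum_value hγ, utility_eq_sum_value hγ]
  refine Finset.sum_le_sum fun w _ => ?_
  refine value_le_value hP hc (h.edist_le_three i w) fun x hne hn h₁ h₂ => ?_
  have hn' : ¬ g.Adj i w := fun e => hn (le_addLink e)
  refine ⟨hn', ?_⟩
  obtain ⟨p, hp, hip⟩ := h.exists_center hi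
  rw [addLink_adj] at h₁ h₂
  rcases h₁ with h₁ | ⟨h₁, h₁'⟩
  · have hx := h.mem_of_adj_leaf hi h₁
    rcases h₂ with h₂ | ⟨⟨rfl, -⟩ | ⟨rfl, -⟩, -⟩
    exacts [⟨x, h₁, h₂⟩, absurd hx hi, absurd hx hj]
  · obtain rfl : x = j := by grind
    have h₂' : g.Adj x w := by grind
    refine ⟨p, hip, h.adj_center hp (h.mem_of_adj_leaf hj h₂') ?_⟩
    rintro rfl
    exact hn' hip

theorem utility_deleteLink_le (h : IsKStarOn k g C) (hP : P.Decaying) (hγ : P.γ = 0)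
    (hc : P.c = P.b 1 - P.b 3) (hij : g.Adj i j) :
    utility P (deleteLink g i j) i ≤ utility P g i := by
  classical
  rw [utility_eq_sum_value hγ, utility_eq_sum_value hγ]
  have hw : ∀ w, w ≠ j →
      P.value ((deleteLink g i j).edist i w) ≤ P.value (g.edist i w) := by
    intro w hwj
    refine value_le_value hP hc (h.edist_le_three i w) fun x hne hn h₁ h₂ => ?_
    rw [deleteLink_adj] at hn h₁ h₂
    refine ⟨fun e => hn ⟨e, fun e' => hwj ?_⟩, x, h₁.1, h₂.1⟩
    have := hij.ne
    simp at e'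
    tauto
  by_cases hC : i ∈ C ∧ j ∈ C
  · -- The new distance two to `j` is paid for by the distance three to a leaf of `j`.
    obtain ⟨y, hy, hjy⟩ := h.exists_leaf hC.2
    have hyj : y ≠ j := fun e => hy (e ▸ hC.2)
    have hiy : i ≠ y := fun e => hy (e ▸ hC.1)
    have hn : ¬ g.Adj i y := fun e => hij.ne (h.eq_of_adj_leaf hy e.symm hjy.symm)
    have h₁ : P.value ((deleteLink g i j).edist i j) ≤ P.b 2 := value_le_b_two hP hc hij.ne
    have h₂ : P.value ((deleteLink g i j).edist i y) ≤ P.b 3 := by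
      refine value_le_b_three hP hc hiy fun x hx hx' => ?_
      rw [deleteLink_adj] at hx hx'
      obtain rfl := h.eq_of_adj_leaf hy hjy.symm hx'.1.symm
      exact hx.2 rfl
    have h₃ := Finset.sum_le_sum (s := (Finset.univ.erase j).erase y) fun w hw' =>
      hw w (by simp at hw'; tauto)
    have hy' : y ∈ Finset.univ.erase j := by simpa using hyj
    rw [← Finset.add_sum_erase _ _ (Finset.mem_univ j), ← Finset.add_sum_erase _ _ hy',
      ← Finset.add_sum_erase _ (fun w => P.value (g.edist i w)) (Finset.mem_univ j),
      ← Finset.add_sum_erase _ (fun w => P.value (g.edist i w)) hy', value_adj hij,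
      value_of_adj_of_adj hiy hn hij hjy]
    linarith
  · refine Finset.sum_le_sum fun w _ => ?_
    by_cases hwj : w = j
    · subst hwj
      refine value_le_value hP hc (h.edist_le_three i w) fun x hne hn h₁ h₂ => ?_
      rw [deleteLink_adj] at h₁ h₂
      exfalso
      rcases not_and_or.mp hC with hi | hj
      · exact h₁.2 (by rw [h.eq_of_adj_leaf hi h₁.1 hij])
      · exact h₂.2 (by rw [h.eq_of_adj_leaf hj h₂.1.symm hij.symm])
    · exact hw w hwj

theorem pairwiseStable (h : IsKStarOn k g C) (hP : P.Decaying) (hγ : P.γ = 0)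
    (hc : P.c = P.b 1 - P.b 3) : PairwiseStable P g := by
  refine ⟨fun i j hij => h.utility_deleteLink_le hP hγ hc hij, fun i j hij hadj hlt => ?_⟩
  by_cases hi : i ∈ C
  · exact absurd hlt (h.utility_addLink_center_lt hP hγ hc hi hij hadj).not_gt
  by_cases hj : j ∈ C
  · rw [addLink_comm]
    exact h.utility_addLink_center_lt hP hγ hc hj hij.symm fun e => hadj e.symm
  · exact absurd hlt (h.utility_addLink_leaf_le hP hγ hc hi hj).not_gt

end IsKStarOn

/-- At a pairwise stable network no node has an improving move. -/
theorem PairwiseStable.not_evolutionStep {V : Type*} [Fintype V] {P : Params}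
    {g g' : SimpleGraph V} (h : PairwiseStable P g) : ¬ EvolutionStep P g g' := by
  rintro ⟨i, hmove | ⟨j, hij, rfl⟩ | ⟨j, hij, hadj, rfl, hacc⟩, -, hlt⟩
  · exact hlt.ne (by rw [hmove])
  · exact (h.1 i j hij).not_gt hlt
  · exact (h.2 i j hij hadj hlt).not_ge hacc

/-! ### Entry into a k-star -/

section Counting

variable {V : Type*} [Fintype V] {k : ℕ} {g : SimpleGraph V} {C : Finset V} {p x : V}

theorem IsKStarOn.degree_center (h : IsKStarOn k g C) (hp : p ∈ C)
    [Fintype (g.neighborSet p)] : g.degree p = leafCount g C p + (k - 1) := by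
  classical
  have e : g.neighborFinset p =
      (Finset.univ.filter fun x => x ∉ C ∧ g.Adj p x) ∪ C.erase p := by
    ext x
    simp only [SimpleGraph.mem_neighborFinset, Finset.mem_union, Finset.mem_filter,
      Finset.mem_univ, true_and, Finset.mem_erase]
    constructor
    · intro hx
      by_cases hxC : x ∈ C
      exacts [.inr ⟨hx.ne', hxC⟩, .inl ⟨hxC, hx⟩]
    · rintro (hx | hx)
      exacts [hx.2, h.adj_center hp hx.2 hx.1.symm]
  have hd : Disjoint (Finset.univ.filter fun x => x ∉ C ∧ g.Adj p x) (C.erase p) := by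
    rw [Finset.disjoint_left]
    intro x hx hx'
    exact (Finset.mem_filter.mp hx).2.1 (Finset.mem_of_mem_erase hx')
  rw [← SimpleGraph.card_neighborFinset_eq_degree, e, Finset.card_union_of_disjoint hd,
    Finset.card_erase_of_mem hp, h.card, leafCount]

theorem IsKStarOn.degree_leaf (h : IsKStarOn k g C) (hx : x ∉ C)
    [Fintype (g.neighborSet x)] : g.degree x = 1 := by
  classical
  obtain ⟨p, -, hxp⟩ := h.leaf x hx
  rw [← SimpleGraph.card_neighborFinset_eq_degree, Finset.card_eq_one]
  exact ⟨p, by ext y; simp [hxp]⟩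

theorem IsKStarOn.card_eq (h : IsKStarOn k g C) :
    Fintype.card V = k + ∑ p ∈ C, leafCount g C p := by
  classical
  have e : ∑ p ∈ C, leafCount g C p = Cᶜ.card := by
    have : ∀ p ∈ C, leafCount g C p = ∑ x ∈ Cᶜ, if g.Adj p x then 1 else 0 := by
      intro p _
      rw [← Finset.card_filter, leafCount]
      congr 1
      ext x
      simp
    rw [Finset.sum_congr rfl this, Finset.sum_comm, Finset.card_eq_sum_ones]
    refine Finset.sum_congr rfl fun x hx => ?_
    obtain ⟨q, hq, hxq⟩ := h.leaf x (by simpa using hx)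
    rw [Finset.sum_eq_single q]
    · simp [((hxq q).mpr rfl).symm]
    · intro r _ hr
      exact if_neg fun e => hr ((hxq r).mp e.symm)
    · exact fun hq' => absurd hq hq'
  rw [e, ← h.card, Finset.card_add_card_compl]

end Counting

section Attach

variable {n k : ℕ} {g : SimpleGraph (Fin n)} {C : Finset (Fin n)} {P : Params} {t u v p q : Fin n}

theorem attach_adj_castSucc : (attach g t).Adj u.castSucc v.castSucc ↔ g.Adj u v := by
  have h₁ := Fin.castSucc_lt_last u
  have h₂ := Fin.castSucc_lt_last v
  have hm : (g.map Fin.castSuccEmb).Adj u.castSucc v.castSucc ↔ g.Adj u v :=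
    SimpleGraph.map_adj_apply
  rw [attach, SimpleGraph.sup_adj, hm]
  simp [SimpleGraph.edge_adj, h₁.ne, h₂.ne]

theorem attach_adj_last {w : Fin (n + 1)} :
    (attach g t).Adj (Fin.last n) w ↔ w = t.castSucc := by
  have h₁ := Fin.castSucc_lt_last t
  have : ∀ u : Fin n, Fin.castSucc u ≠ Fin.last n := fun u => (Fin.castSucc_lt_last u).ne
  have hm : ¬ (g.map Fin.castSuccEmb).Adj (Fin.last n) w := by
    rw [SimpleGraph.map_adj]
    rintro ⟨u, -, -, hu, -⟩
    exact this u hu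
  rw [attach, SimpleGraph.sup_adj, SimpleGraph.edge_adj]
  grind

theorem attach_adj_last_right {w : Fin (n + 1)} :
    (attach g t).Adj w (Fin.last n) ↔ w = t.castSucc := by
  rw [SimpleGraph.adj_comm, attach_adj_last]

theorem entrantUtility_eq_sum (hγ : P.γ = 0) (g : SimpleGraph (Fin n)) (t : Fin n)
    [Fintype (g.neighborSet t)] :
    entrantUtility P g t = -P.c₀ * g.degree t +
      ∑ w : Fin n, P.value ((attach g t).edist (Fin.last n) w.castSucc) := by
  rw [entrantUtility, utility_eq_sum_value hγ, Fin.sum_univ_castSucc, value_self, add_zero]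
  congr!

theorem sum_ite_adj {V : Type*} [Fintype V] (g : SimpleGraph V) [DecidableRel g.Adj] (v : V)
    (r : ℝ) : ∑ w, (if g.Adj v w then r else 0) = g.degree v * r := by
  rw [← Finset.sum_filter, Finset.sum_const, nsmul_eq_mul,
    ← SimpleGraph.card_neighborFinset_eq_degree, SimpleGraph.neighborFinset_eq_filter]

/-- Entering through a center: the center and all nodes at distance three are worth `b₃`, the
neighbours of the center `b₂`. -/
theorem IsKStarOn.entrantUtility_center (h : IsKStarOn k g C) (hP : P.Decaying) (hγ : P.γ = 0)
    (hc : P.c = P.b 1 - P.b 3) (ht : t ∈ C) :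
    entrantUtility P g t = n * P.b 3 + (leafCount g C t + (k - 1) : ℕ) *
      (P.b 2 - P.b 3 - P.c₀) := by
  classical
  have hval : ∀ w : Fin n, P.value ((attach g t).edist (Fin.last n) w.castSucc) =
      P.b 3 + if g.Adj t w then P.b 2 - P.b 3 else 0 := by
    intro w
    have hlt : (attach g t).Adj (Fin.last n) t.castSucc := attach_adj_last.mpr rfl
    have hne : Fin.last n ≠ w.castSucc := (Fin.castSucc_lt_last w).ne'
    by_cases htw : g.Adj t w
    · have hn : ¬ (attach g t).Adj (Fin.last n) w.castSucc := fun e =>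
        htw.ne' (Fin.castSucc_injective _ (attach_adj_last.mp e))
      rw [value_of_adj_of_adj hne hn hlt (attach_adj_castSucc.mpr htw), if_pos htw]
      ring
    · rw [if_neg htw, add_zero]
      apply le_antisymm
      · refine value_le_b_three hP hc hne fun x hx hx' => ?_
        rw [attach_adj_last.mp hx, attach_adj_castSucc] at hx'
        exact htw hx'
      · rcases eq_or_ne t w with rfl | htw'
        · rw [value_adj hlt]
          linarith
        obtain ⟨q, h₁, h₂⟩ := h.exists_adj_adj ht htw' htw
        exact b_three_le_value hP hc hne (NetworkFormation.edist_le_three hlt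
          (attach_adj_castSucc.mpr h₁) (attach_adj_castSucc.mpr h₂))
  rw [entrantUtility_eq_sum hγ, Finset.sum_congr rfl fun w _ => hval w, Finset.sum_add_distrib,
    sum_ite_adj, h.degree_center ht]
  simp
  ring

/-- Entering through a leaf of `p`: the center `p` is at distance two, its neighbours are worth
`b₃`, and everyone else is at distance at least four. -/
theorem IsKStarOn.entrantUtility_leaf_le (h : IsKStarOn k g C) (hP : P.Decaying) (hγ : P.γ = 0)
    (hc : P.c = P.b 1 - P.b 3) (ht : t ∉ C) (htp : g.Adj t p) :
    entrantUtility P g t ≤ n * P.b 4 + (leafCount g C p + (k - 1) : ℕ) * (P.b 3 - P.b 4) +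
      (P.b 2 - P.b 4) - P.c₀ := by
  classical
  have h34 := hP.step 3 (by norm_num)
  have hval : ∀ w : Fin n, P.value ((attach g t).edist (Fin.last n) w.castSucc) ≤
      P.b 4 + (if g.Adj p w then P.b 3 - P.b 4 else 0) + if w = p then P.b 2 - P.b 4 else 0 := by
    intro w
    have hne : Fin.last n ≠ w.castSucc := (Fin.castSucc_lt_last w).ne'
    by_cases hwp : w = p
    · subst hwp
      rw [if_neg (SimpleGraph.irrefl _), if_pos rfl]
      linarith [value_le_b_two (g := attach g t) hP hc hne]
    · have hwt : ¬ g.Adj t w := fun e => hwp (h.eq_of_adj_leaf ht e htp)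
      rw [if_neg hwp, add_zero]
      split_ifs with hpw
      · have := value_le_b_three (g := attach g t) hP hc hne fun x hx hx' => by
          rw [attach_adj_last.mp hx, attach_adj_castSucc] at hx'
          exact hwt hx'
        linarith
      · have htw : t ≠ w := by
          rintro rfl
          exact hpw htp.symm
        rw [add_zero]
        refine value_le_b hP (by norm_num) (succ_le_edist hne fun x hx => ?_)
        rw [attach_adj_last.mp hx]
        refine three_le_edist (fun e => htw (Fin.castSucc_injective _ e))
          (attach_adj_castSucc.not.mpr hwt) fun y => ?_
        cases y using Fin.lastCases with
        | last =>
          intro _ hy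
          exact htw (Fin.castSucc_injective _ (attach_adj_last.mp hy)).symm
        | cast y =>
          rw [attach_adj_castSucc, attach_adj_castSucc]
          intro hy
          rwa [h.eq_of_adj_leaf ht hy htp]
  rw [entrantUtility_eq_sum hγ, h.degree_leaf ht]
  have hsum := Finset.sum_le_sum (s := Finset.univ) fun w _ => hval w
  rw [Finset.sum_add_distrib, Finset.sum_add_distrib, sum_ite_adj, Finset.sum_ite_eq',
    if_pos (Finset.mem_univ p), h.degree_center (h.mem_of_adj_leaf ht htp)] at hsum
  simp at hsum ⊢
  linarith

/-- An entrant strictly prefers a center with the fewest leaves to any leaf. -/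
theorem IsKStarOn.entrantUtility_leaf_lt (h : IsKStarOn k g C) (hk : 3 ≤ k) (hP : P.Decaying)
    (hγ : P.γ = 0) (hc : P.c = P.b 1 - P.b 3) (hlow : P.b 2 - P.b 3 < P.c₀)
    (hupp : P.c₀ < P.b 2 - P.b 4) (hq : q ∈ C)
    (hmin : ∀ r ∈ C, leafCount g C q ≤ leafCount g C r) (ht : t ∉ C) :
    entrantUtility P g t < entrantUtility P g q := by
  obtain ⟨p, hp, htp⟩ := h.exists_center ht
  refine (h.entrantUtility_leaf_le hP hγ hc ht htp).trans_lt ?_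
  rw [h.entrantUtility_center hP hγ hc hq]
  have hcard := h.card_eq
  rw [Fintype.card_fin, ← Finset.add_sum_erase _ _ hp] at hcard
  have hothers : (k - 1) * leafCount g C q ≤ ∑ r ∈ C.erase p, leafCount g C r := by
    have := Finset.card_nsmul_le_sum (C.erase p) (leafCount g C) (leafCount g C q)
      fun r hr => hmin r (Finset.mem_of_mem_erase hr)
    rwa [Finset.card_erase_of_mem hp, h.card, smul_eq_mul] at this
  have hone := h.one_le q hq
  obtain ⟨k, rfl⟩ : ∃ j, k = j + 2 := ⟨k - 2, by omega⟩
  simp only [Nat.add_succ_sub_one] at hothers ⊢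
  set m := leafCount g C q
  set m' := leafCount g C p
  -- Each of the other `k - 1 ≥ 2` centers than `p` has at least `m ≥ 1` leaves, and
  -- `(k - 1) * m ≥ m + (k - 2)`.
  have h₁ : m' + (k + 1) + (m + (k + 1)) ≤ n := by nlinarith
  have h₂ : m' + (k + 1) + 1 < n := by omega
  have h₁' : ((m' + (k + 1) : ℕ) : ℝ) + (m + (k + 1) : ℕ) ≤ n := by exact_mod_cast h₁
  have h₂' : ((m' + (k + 1) : ℕ) : ℝ) + 1 < n := by exact_mod_cast h₂
  nlinarith [mul_nonneg (sub_nonneg.mpr h₁') (sub_pos.mpr hlow).le,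
    mul_pos (sub_pos.mpr h₂') (sub_pos.mpr hupp)]

theorem IsKStarOn.accepts (h : IsKStarOn k g C) (hP : P.Decaying) (hγ : P.γ = 0)
    (hc : P.c = P.b 1 - P.b 3) (ht : t ∈ C) : Accepts P g t := by
  rw [Accepts, utility_eq_sum_value hγ, utility_eq_sum_value hγ, Fin.sum_univ_castSucc]
  refine le_add_of_le_of_nonneg (Finset.sum_le_sum fun w _ => ?_) (value_nonneg hP hc)
  rcases eq_or_ne t w with rfl | hne
  · rw [value_self, value_self]
  have hne' : t.castSucc ≠ w.castSucc := fun e => hne (Fin.castSucc_injective _ e)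
  by_cases hadj : g.Adj t w
  · rw [value_adj hadj, value_adj (attach_adj_castSucc.mpr hadj)]
  · obtain ⟨q, h₁, h₂⟩ := h.exists_adj_adj ht hne hadj
    rw [value_of_adj_of_adj hne hadj h₁ h₂, value_of_adj_of_adj hne'
      (attach_adj_castSucc.not.mpr hadj) (attach_adj_castSucc.mpr h₁) (attach_adj_castSucc.mpr h₂)]

theorem IsKStarOn.exists_min (h : IsKStarOn k g C) (hk : 3 ≤ k) :
    ∃ q ∈ C, ∀ r ∈ C, leafCount g C q ≤ leafCount g C r :=
  C.exists_min_image _ (Finset.card_pos.mp (by rw [h.card]; omega))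

/-- The best responses of an entrant are the centers with the fewest leaves. -/
theorem IsKStarOn.isEntryChoice_iff (h : IsKStarOn k g C) (hk : 3 ≤ k) (hP : P.Decaying)
    (hγ : P.γ = 0) (hc : P.c = P.b 1 - P.b 3) (hlow : P.b 2 - P.b 3 < P.c₀)
    (hupp : P.c₀ < P.b 2 - P.b 4) :
    IsEntryChoice P g t ↔ t ∈ C ∧ ∀ r ∈ C, leafCount g C t ≤ leafCount g C r := by
  have hcenter : ∀ q ∈ C, ∀ r ∈ C, leafCount g C q ≤ leafCount g C r ↔
      entrantUtility P g r ≤ entrantUtility P g q := by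
    intro q hq r hr
    rw [h.entrantUtility_center hP hγ hc hq, h.entrantUtility_center hP hγ hc hr,
      add_le_add_iff_left, mul_le_mul_right_of_neg (by linarith)]
    norm_cast
    omega
  constructor
  · rintro ⟨-, -, hbest⟩
    obtain ⟨q, hq, hmin⟩ := h.exists_min hk
    have hqt := hbest q (h.accepts hP hγ hc hq)
    have ht : t ∈ C := by
      by_contra ht
      exact hqt.not_gt (h.entrantUtility_leaf_lt hk hP hγ hc hlow hupp hq hmin ht)
    exact ⟨ht, fun r hr => (hcenter t ht r hr).mpr (hbest r (h.accepts hP hγ hc hr))⟩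
  · rintro ⟨ht, hmin⟩
    refine ⟨h.accepts hP hγ hc ht, ?_, fun r _ => ?_⟩
    · classical
      have hdeg : leafCount g C t + (k - 1) ≤ n := by
        rw [← h.degree_center ht]
        simpa using (g.degree_lt_card_verts t).le
      have hdeg' : ((leafCount g C t + (k - 1) : ℕ) : ℝ) ≤ n := by exact_mod_cast hdeg
      have hpos : (0 : ℝ) < (leafCount g C t + (k - 1) : ℕ) := by
        have := h.one_le t ht
        exact_mod_cast (by omega)
      have hδ : 0 < P.b 2 - P.c₀ := by linarith [hP.pos 4 (by norm_num)]
      rw [h.entrantUtility_center hP hγ hc ht]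
      nlinarith [mul_nonneg (sub_nonneg.mpr hdeg') (hP.pos 3 (by norm_num)).le,
        mul_pos hpos hδ]
    · by_cases hr : r ∈ C
      · exact (hcenter t ht r hr).mp (hmin r hr)
      · exact (h.entrantUtility_leaf_lt hk hP hγ hc hlow hupp ht hmin hr).le

theorem leafCount_attach [DecidableEq (Fin n)] (C : Finset (Fin n)) (p : Fin n) :
    leafCount (attach g t) (C.map Fin.castSuccEmb) p.castSucc =
      leafCount g C p + if p = t then 1 else 0 := by
  classical
  simp only [leafCount, Finset.card_filter]
  rw [Fin.sum_univ_castSucc]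
  congr 1
  · refine Finset.sum_congr rfl fun x _ => ?_
    simp [attach_adj_castSucc]
  · have : ∀ u : Fin n, Fin.castSucc u ≠ Fin.last n := fun u => (Fin.castSucc_lt_last u).ne
    simp [attach_adj_last_right, this]

/-- Linking a new node to a center with the fewest leaves yields a `k`-star. -/
theorem IsKStarOn.attach (h : IsKStarOn k g C) (ht : t ∈ C)
    (hmin : ∀ r ∈ C, leafCount g C t ≤ leafCount g C r) :
    IsKStarOn k (attach g t) (C.map Fin.castSuccEmb) where
  card := by rw [Finset.card_map, h.card]
  clique := by
    rintro _ hp _ hq hne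
    obtain ⟨p, hp', rfl⟩ := Finset.mem_map.mp hp
    obtain ⟨q, hq', rfl⟩ := Finset.mem_map.mp hq
    exact attach_adj_castSucc.mpr (h.adj_center hp' hq' fun e => hne (by rw [e]))
  leaf := by
    intro x hx
    cases x using Fin.lastCases with
    | last => exact ⟨t.castSucc, Finset.mem_map_of_mem Fin.castSuccEmb ht, fun y => attach_adj_last⟩
    | cast x =>
      have hx' : x ∉ C := fun hx' => hx (Finset.mem_map_of_mem Fin.castSuccEmb hx')
      obtain ⟨p, hp, hxp⟩ := h.leaf x hx'
      refine ⟨p.castSucc, Finset.mem_map_of_mem Fin.castSuccEmb hp, fun y => ?_⟩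
      cases y using Fin.lastCases with
      | last =>
        rw [attach_adj_last_right]
        exact iff_of_false (fun e => hx' (Fin.castSucc_injective _ e ▸ ht))
          (Fin.castSucc_lt_last p).ne'
      | cast y => rw [attach_adj_castSucc, hxp, Fin.castSucc_inj]
  one_le := by
    intro p hp
    obtain ⟨p, hp', rfl⟩ := Finset.mem_map.mp hp
    exact (h.one_le p hp').trans (by rw [Fin.castSuccEmb_apply, leafCount_attach]; omega)
  balanced := by
    intro p hp q hq
    obtain ⟨p, hp', rfl⟩ := Finset.mem_map.mp hp
    obtain ⟨q, hq', rfl⟩ := Finset.mem_map.mp hq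
    have h₁ := h.balanced p hp' q hq'
    have h₂ := hmin q hq'
    rw [Fin.castSuccEmb_apply, Fin.castSuccEmb_apply, leafCount_attach, leafCount_attach]
    split_ifs with e₁ e₂ e₂ <;> subst_vars <;> omega

end Attach

/-! ### The base graph -/

theorem leafCount_kStarBase (k : ℕ) (p : Fin (2 * k)) (hp : p.val < k) :
    leafCount (kStarBase k) (Finset.univ.filter fun i => i.val < k) p = 1 := by
  classical
  rw [leafCount, Finset.card_eq_one]
  refine ⟨⟨k + p.val, by omega⟩, ?_⟩
  ext x
  simp only [Finset.mem_filter, Finset.mem_univ, true_and, Finset.mem_singleton, kStarBase,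
    Fin.ext_iff, ne_eq]
  omega

theorem isKStarOn_kStarBase (k : ℕ) :
    IsKStarOn k (kStarBase k) (Finset.univ.filter fun i => i.val < k) where
  card := by
    rcases Nat.eq_zero_or_pos k with rfl | hk
    · simp
    have e : (Finset.univ.filter fun i : Fin (2 * k) => i.val < k) =
        Finset.Iio ⟨k, by omega⟩ := by
      ext x
      simp [Fin.lt_def]
    rw [e, Fin.card_Iio]
  clique := by
    intro p hp q hq hne
    simp only [Finset.coe_filter, Finset.mem_univ, true_and, Set.mem_ofPred_eq] at hp hq
    exact ⟨hne, .inl ⟨hp, hq⟩⟩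
  leaf := by
    intro x hx
    simp only [Finset.mem_filter, Finset.mem_univ, true_and, not_lt] at hx
    refine ⟨⟨x.val - k, by omega⟩, by simp; omega, fun y => ?_⟩
    simp only [kStarBase, Fin.ext_iff, ne_eq]
    omega
  one_le := by
    intro p hp
    rw [leafCount_kStarBase k p (by simpa using hp)]
  balanced := by
    intro p hp q hq
    rw [leafCount_kStarBase k p (by simpa using hp), leafCount_kStarBase k q (by simpa using hq)]
    norm_num

/-! ### The formation process -/

/-- The formation process never leaves the `k`-stars: they are stable, so that no evolution step
occurs, and an entrant chooses a center with the fewest leaves. -/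
theorem Reached.isKStar {P : Params} {k : ℕ} (hk : 3 ≤ k) (hP : P.Decaying)
    (hγ : P.γ = 0) (hc : P.c = P.b 1 - P.b 3) (hlow : P.b 2 - P.b 3 < P.c₀)
    (hupp : P.c₀ < P.b 2 - P.b 4) {n : ℕ} {g : SimpleGraph (Fin n)}
    (h : Reached P (kStarBase k) n g) : ∃ C, IsKStarOn k g C := by
  induction h with
  | base => exact ⟨_, isKStarOn_kStarBase k⟩
  | evolve _ hstep ih =>
    obtain ⟨C, hC⟩ := ih
    exact absurd hstep (hC.pairwiseStable hP hγ hc).not_evolutionStep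
  | enter _ _ hchoice ih =>
    obtain ⟨C, hC⟩ := ih
    rw [hC.isEntryChoice_iff hk hP hγ hc hlow hupp] at hchoice
    exact ⟨_, hC.attach hchoice.1 hchoice.2⟩

theorem uniqueResultingTopology_kStar {P : Params} {k : ℕ} (hk : 3 ≤ k) (hP : P.Decaying)
    (hγ : P.γ = 0) (hc : P.c = P.b 1 - P.b 3) (hlow : P.b 2 - P.b 3 < P.c₀)
    (hupp : P.c₀ < P.b 2 - P.b 4) :
    UniqueResultingTopology P (kStarBase k) fun _ g => IsKStar k g := by
  have hstar {n : ℕ} {g : SimpleGraph (Fin n)} (h : Reached P (kStarBase k) n g) :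
      ∃ C, IsKStarOn k g C := h.isKStar hk hP hγ hc hlow hupp
  have hentry {n : ℕ} {g : SimpleGraph (Fin n)} (h : Reached P (kStarBase k) n g) :
      ∃ t, IsEntryChoice P g t := by
    obtain ⟨C, hC⟩ := hstar h
    obtain ⟨t, ht⟩ := hC.exists_min hk
    exact ⟨t, (hC.isEntryChoice_iff hk hP hγ hc hlow hupp).mpr ht⟩
  refine ⟨fun n g h _ => isKStar_iff.mpr (hstar h), ?_, fun n g h _ => hentry h, ?_⟩
  · rintro n g h ⟨s, rfl, hs⟩
    obtain ⟨C, hC⟩ := hstar h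
    exact (hC.pairwiseStable hP hγ hc).not_evolutionStep (hs 0)
  · intro n hn
    induction n, hn using Nat.le_induction with
    | base => exact ⟨_, .base, (isKStarOn_kStarBase k).pairwiseStable hP hγ hc⟩
    | succ n _ ih =>
      obtain ⟨g, hg, hst⟩ := ih
      obtain ⟨t, ht⟩ := hentry hg
      have hg' := Reached.enter hg hst ht
      obtain ⟨C, hC⟩ := hstar hg'
      exact ⟨_, hg', hC.pairwiseStable hP hγ hc⟩

/-! ### Large k-stars -/

theorem exists_isKStarOn {k n : ℕ} (hk : 3 ≤ k) (hn : 2 * k ≤ n) :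
    ∃ (g : SimpleGraph (Fin n)) (C : Finset (Fin n)), IsKStarOn k g C := by
  induction n, hn using Nat.le_induction with
  | base => exact ⟨_, _, isKStarOn_kStarBase k⟩
  | succ n _ ih =>
    obtain ⟨g, C, h⟩ := ih
    obtain ⟨t, ht, hmin⟩ := h.exists_min hk
    exact ⟨_, _, h.attach ht hmin⟩

theorem exists_isKStarOn_le_leafCount {k : ℕ} (hk : 3 ≤ k) (m : ℕ) :
    ∃ (n : ℕ) (g : SimpleGraph (Fin n)) (C : Finset (Fin n)),
      IsKStarOn k g C ∧ ∀ q ∈ C, m ≤ leafCount g C q := by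
  obtain ⟨g, C, h⟩ := exists_isKStarOn (n := k * (m + 2)) hk (by nlinarith)
  refine ⟨_, g, C, h, fun q hq => ?_⟩
  have hcard := h.card_eq
  have hle : ∑ p ∈ C, leafCount g C p ≤ k * (leafCount g C q + 1) := by
    have := Finset.sum_le_card_nsmul C (leafCount g C) _ fun p hp => h.balanced p hp q hq
    rwa [h.card, smul_eq_mul] at this
  rw [Fintype.card_fin] at hcard
  have : k * (m + 2) ≤ k * (leafCount g C q + 2) := by linarith
  have := Nat.le_of_mul_le_mul_left this (by omega)
  omega

/-! ### Necessity of the conditions on the parameters -/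

namespace IsKStarOn

section Rents

variable {V : Type*} [Fintype V] {k : ℕ} {g : SimpleGraph V} {C : Finset V} {p q x y : V}
  {P : Params}

theorem mem_essential_leaf (h : IsKStarOn k g C) (hx : x ∉ C) (hq : q ∈ C) (hy : y ∉ C)
    (hqy : g.Adj q y) (hxy : x ≠ y) : q ∈ essential g x y := by
  rw [mem_essential]
  refine ⟨fun e => hx (e ▸ hq), hqy.ne, fun w hw => ?_⟩
  have hnil : ¬ w.Nil := SimpleGraph.Walk.not_nil_of_ne hxy
  rw [h.eq_of_adj_leaf hy hqy.symm (w.adj_penultimate hnil).symm]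
  exact w.getVert_mem_support _

theorem card_essential_le (hxp : g.Adj x p) (hpq : g.Adj p q) (hqy : g.Adj q y)
    (hxq : x ≠ q) (hxy : x ≠ y) (hpy : p ≠ y) : (essential g x y).card ≤ 2 := by
  classical
  refine (Finset.card_le_card (t := {p, q}) fun j hj => ?_).trans Finset.card_le_two
  rw [mem_essential] at hj
  have := hj.2.2 (.cons hxp (.cons hpq (.cons hqy .nil)))
    (by simp [SimpleGraph.Walk.cons_isPath_iff, hxp.ne, hpq.ne, hqy.ne, hxq, hxy, hpy])
  simp at this ⊢
  tauto

/-- If a leaf `x` of `p` links to another center `q`, then `x` gets closer to the leaves of `q`.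
The benefit `b₁` of the new link offsets the lost indirect benefit from `q`. -/
theorem utility_addLink_leaf_ge (h : IsKStarOn k g C) (hP : P.Decaying) (hγ : 0 ≤ P.γ)
    (hγ' : P.γ ≤ 1) (hx : x ∉ C) (hq : q ∈ C) (hpq : p ≠ q) (hxp : g.Adj x p) :
    utility P g x - P.c + leafCount g C q * ((1 - P.γ) * (P.b 2 - P.b 3)) ≤
      utility P (addLink g x q) x := by
  classical
  have hxq : x ≠ q := fun e => hx (e ▸ hq)
  have hadj : ¬ g.Adj x q := fun e => hpq (h.eq_of_adj_leaf hx hxp e)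
  set S := Finset.univ.filter fun y => y ∉ C ∧ g.Adj q y with hS
  have hcard : S.card = leafCount g C q := by rw [leafCount]
  have hu := utility_addLink_ge hP hγ hγ' hxq hadj S (by simp [hS, hq])
  have hbr := bridgingBenefits_addLink (g := g) hP hγ x q x ∅ (by simp)
  have hb : P.benefit (g.edist x q) ≤ P.b 1 := by
    rw [← benefit_coe]
    exact hP.benefit_antitone le_rfl (one_le_edist hxq)
  have hsum : S.card • (P.b 2 - P.b 3) ≤ ∑ w ∈ S,
      (P.benefit ((addLink g x q).edist x w) - P.benefit (g.edist x w)) := by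
    refine Finset.card_nsmul_le_sum _ _ _ fun y hy => ?_
    obtain ⟨hy, hqy⟩ := (Finset.mem_filter.mp hy).2
    have hxy : x ≠ y := by
      rintro rfl
      exact hadj hqy.symm
    have h₁ : (addLink g x q).edist x y ≤ (2 : ℕ) :=
      SimpleGraph.edist_le (.cons (addLink_adj_self hxq) (.cons (le_addLink hqy) .nil))
    have h₂ : ((3 : ℕ) : ℕ∞) ≤ g.edist x y := h.three_le_edist_leaf_leaf hx hy hxp hqy.symm hpq
    have h₃ := hP.benefit_antitone (one_le_edist hxy) h₁
    have h₄ := hP.benefit_antitone (by norm_num) h₂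
    rw [benefit_coe] at h₃ h₄
    linarith
  rw [nsmul_eq_mul, hcard] at hsum
  have := mul_le_mul_of_nonneg_left hsum (sub_nonneg.mpr hγ')
  simp only [Finset.sum_empty, mul_zero, add_zero] at hbr
  linarith

/-- If a leaf `x` of `p` links to another center `q`, then `q` earns rents on shorter paths between
`x` and its own leaves. Before, it shared these rents with `p` only, so the gain per leaf is bounded
below. -/
theorem utility_addLink_center_ge (h : IsKStarOn k g C) (hP : P.Decaying) (hγ : 0 ≤ P.γ)
    (hγ' : P.γ ≤ 1) (hx : x ∉ C) (hp : p ∈ C) (hq : q ∈ C) (hpq : p ≠ q) (hxp : g.Adj x p) :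
    utility P g q - P.c + leafCount g C q * (1 / 2 * (P.γ * (P.b 2 - P.b 3))) ≤
      utility P (addLink g x q) q := by
  classical
  have hxq : x ≠ q := fun e => hx (e ▸ hq)
  have hadj : ¬ g.Adj x q := fun e => hpq (h.eq_of_adj_leaf hx hxp e)
  set S := Finset.univ.filter fun y => y ∉ C ∧ g.Adj q y with hS
  have hcard : S.card = leafCount g C q := by rw [leafCount]
  have hxy : ∀ y ∈ S, x ≠ y := by
    rintro y hy rfl
    exact hadj (Finset.mem_filter.mp hy).2.2.symm
  have hess : ∀ y ∈ S, q ∈ essential g x y := fun y hy =>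
    have ⟨hyC, hqy⟩ := (Finset.mem_filter.mp hy).2
    h.mem_essential_leaf hx hq hyC hqy (hxy y hy)
  have hu := utility_addLink_ge hP hγ hγ' hxq.symm (fun e => hadj e.symm) ∅ (by simp)
  have hbr := bridgingBenefits_addLink (g := g) hP hγ q x x S hess
  have hb : P.benefit (g.edist q x) ≤ P.b 1 := by
    rw [← benefit_coe]
    exact hP.benefit_antitone le_rfl (one_le_edist hxq.symm)
  have hsum : S.card • (P.γ * (P.b 2 - P.b 3)) ≤ ∑ y ∈ S,
      (bridgingTerm P (addLink g q x) x y - bridgingTerm P g x y) := by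
    refine Finset.card_nsmul_le_sum _ _ _ fun y hyS => ?_
    obtain ⟨hy, hqy⟩ := (Finset.mem_filter.mp hyS).2
    have h₁ : (addLink g q x).edist x y ≤ (2 : ℕ) :=
      SimpleGraph.edist_le (.cons (addLink_adj_self hxq.symm).symm (.cons (le_addLink hqy) .nil))
    have h₂ : ((3 : ℕ) : ℕ∞) ≤ g.edist x y := h.three_le_edist_leaf_leaf hx hy hxp hqy.symm hpq
    have h₃ := hP.benefit_antitone (one_le_edist (hxy y hyS)) h₁
    have h₄ := hP.benefit_antitone (by norm_num) h₂
    rw [benefit_coe] at h₃ h₄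
    have hpos' : (0 : ℝ) < (essential (addLink g q x) x y).card := by
      exact_mod_cast Finset.card_pos.mpr ⟨q, mem_essential_addLink (hess y hyS)⟩
    have hcard' : ((essential (addLink g q x) x y).card : ℝ) ≤ (essential g x y).card := by
      exact_mod_cast Finset.card_le_card (essential_mono le_addLink x y)
    have hcard₂ : ((essential g x y).card : ℝ) ≤ 2 := by
      exact_mod_cast card_essential_le hxp (h.adj_center hp hq hpq) hqy hxq (hxy y hyS)
        fun e => hy (e ▸ hp)
    have hpos : (0 : ℝ) < (essential g x y).card := hpos'.trans_le hcard'
    have hb2 := hP.pos 2 (by norm_num)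
    have hb3 := hP.step 2 (by norm_num)
    calc P.γ * (P.b 2 - P.b 3) = P.γ / 2 * (2 * (P.b 2 - P.b 3)) := by ring
      _ ≤ P.γ / (essential g x y).card * (2 * (P.b 2 - P.b 3)) := by
        have : 0 ≤ P.b 2 - P.b 3 := by linarith
        gcongr
      _ = P.γ / (essential g x y).card * (2 * P.b 2) -
          P.γ / (essential g x y).card * (2 * P.b 3) := by ring
      _ ≤ bridgingTerm P (addLink g q x) x y - bridgingTerm P g x y := by
        unfold bridgingTerm
        gcongr
  rw [nsmul_eq_mul, hcard] at hsum
  simp only [Finset.sum_empty, mul_zero, add_zero] at hu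
  rw [addLink_comm]
  linarith

end Rents

end IsKStarOn

/-- With positive rents, a leaf and another center with sufficiently many leaves would both gain
from a link. -/
theorem γ_eq_zero_of_stable {P : Params} {k : ℕ} (hk : 3 ≤ k) (hP : P.Decaying)
    (hγ : 0 ≤ P.γ) (hγ' : P.γ < 1)
    (hst : ∀ (n : ℕ) (g : SimpleGraph (Fin n)), IsKStar k g → PairwiseStable P g) :
    P.γ = 0 := by
  by_contra hne
  have hγ0 : 0 < P.γ := lt_of_le_of_ne hγ (Ne.symm hne)
  have hb : 0 < P.b 2 - P.b 3 := sub_pos.mpr (hP.step 2 (by norm_num))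
  have hε₁ : 0 < (1 - P.γ) * (P.b 2 - P.b 3) := mul_pos (sub_pos.mpr hγ') hb
  have hε₂ : 0 < 1 / 2 * (P.γ * (P.b 2 - P.b 3)) := by positivity
  -- The gain per leaf is positive for both ends, while the other effects cost at most `c` in total.
  obtain ⟨m₁, hm₁⟩ := Archimedean.arch (P.c + 1) hε₁
  obtain ⟨m₂, hm₂⟩ := Archimedean.arch (P.c + 1) hε₂
  obtain ⟨n, g, C, h, hm⟩ := exists_isKStarOn_le_leafCount hk (max m₁ m₂)
  obtain ⟨p, hp, q, hq, hpq⟩ := Finset.one_lt_card.mp (by rw [h.card]; omega : 1 < C.card)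
  obtain ⟨x, hx, hpx⟩ := h.exists_leaf hp
  have h₁ := h.utility_addLink_leaf_ge hP hγ hγ'.le hx hq hpq hpx.symm
  have h₂ := h.utility_addLink_center_ge hP hγ hγ'.le hx hp hq hpq hpx.symm
  rw [nsmul_eq_mul] at hm₁ hm₂
  have hm₁' : (m₁ : ℝ) ≤ leafCount g C q := by exact_mod_cast (le_max_left _ _).trans (hm q hq)
  have hm₂' : (m₂ : ℝ) ≤ leafCount g C q := by exact_mod_cast (le_max_right _ _).trans (hm q hq)
  have h₁' := mul_le_mul_of_nonneg_right hm₁' hε₁.le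
  have h₂' := mul_le_mul_of_nonneg_right hm₂' hε₂.le
  have := (hst n g (isKStar_iff.mpr ⟨C, h⟩)).2 x q (fun e => hx (e ▸ hq))
    (fun e => hpq (h.eq_of_adj_leaf hx hpx.symm e)) (by linarith)
  linarith

namespace IsKStarOn

variable {V : Type*} [Fintype V] {k : ℕ} {g : SimpleGraph V} {C : Finset V} {P : Params}

/-- Stability against a link between leaves of different centers. -/
theorem link_value_le_b_three (h : IsKStarOn k g C) (hk : 3 ≤ k) (hP : P.Decaying) (hγ : P.γ = 0)
    (hst : PairwiseStable P g) : P.b 1 - P.c ≤ P.b 3 := by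
  obtain ⟨p, hp, q, hq, hpq⟩ := Finset.one_lt_card.mp (by rw [h.card]; omega : 1 < C.card)
  obtain ⟨x, hx, hpx⟩ := h.exists_leaf hp
  obtain ⟨y, hy, hqy⟩ := h.exists_leaf hq
  have hxy : x ≠ y := by
    rintro rfl
    exact hpq (h.eq_of_adj_leaf hx hpx.symm hqy.symm)
  have hadj : ¬ g.Adj x y := fun e => hy (h.mem_of_adj_leaf hx e)
  have hgain : ∀ i j, i ≠ j → ¬ g.Adj i j → ((3 : ℕ) : ℕ∞) ≤ g.edist i j →
      utility P g i + (P.b 1 - P.c - P.b 3) ≤ utility P (addLink g i j) i := by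
    intro i j hij hn h3
    have hu := utility_addLink_ge hP hγ.ge (by rw [hγ]; norm_num) hij hn ∅ (by simp)
    have hbr := bridgingBenefits_addLink (g := g) hP hγ.ge i j i ∅ (by simp)
    have hb := hP.benefit_antitone (by norm_num) h3
    rw [benefit_coe] at hb
    simp only [Finset.sum_empty, mul_zero, add_zero] at hu hbr
    linarith
  by_contra! hlt
  have h3 : ((3 : ℕ) : ℕ∞) ≤ g.edist x y :=
    h.three_le_edist_leaf_leaf hx hy hpx.symm hqy.symm hpq
  have h₁ := hgain x y hxy hadj h3
  have h₂ := hgain y x hxy.symm (fun e => hadj e.symm) (by rwa [SimpleGraph.edist_comm])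
  have h₃ := hst.2 x y hxy hadj (by linarith)
  rw [addLink_comm] at h₃
  linarith

/-- Stability against the deletion of a link with a center that has a single leaf: only this center,
now at distance two, and its leaf, now at distance three, are affected. -/
theorem b_three_le_link_value (h : IsKStarOn k g C) (hk : 3 ≤ k) (hP : P.Decaying) (hγ : P.γ = 0)
    (hst : PairwiseStable P g) {q : V} (hq : q ∈ C) (hone : leafCount g C q = 1) :
    P.b 3 ≤ P.b 1 - P.c := by
  classical
  obtain ⟨p, hp, hpq⟩ := Finset.exists_mem_ne (by rw [h.card]; omega : 1 < C.card) q
  obtain ⟨r, hr, hrpq⟩ := Finset.exists_mem_notMem_of_card_lt_card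
    (s := {p, q}) (t := C) (Finset.card_le_two.trans_lt (by rw [h.card]; omega))
  obtain ⟨hrp, hrq⟩ : r ≠ p ∧ r ≠ q := by simpa using hrpq
  rw [leafCount, Finset.card_eq_one] at hone
  obtain ⟨y, hy'⟩ := hone
  have hyq : ∀ w, (w ∉ C ∧ g.Adj q w) ↔ w = y := fun w => by
    simpa using Finset.ext_iff.mp hy' w
  obtain ⟨hy, hqy⟩ := (hyq y).mpr rfl
  have hadj := h.adj_center hp hq hpq
  have hpy : p ≠ y := fun e => hy (e ▸ hp)
  have hny : ¬ g.Adj p y := fun e => hpq (h.eq_of_adj_leaf hy e.symm hqy.symm)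
  have hdel : ∀ {u v : V}, g.Adj u v → ¬ (u = p ∧ v = q) → ¬ (u = q ∧ v = p) →
      (deleteLink g p q).Adj u v := by
    intro u v huv h₁ h₂
    rw [deleteLink_adj]
    refine ⟨huv, fun e => ?_⟩
    simp at e
    tauto
  have hpr := hdel (h.adj_center hp hr hrp.symm) (by tauto) (by tauto)
  have hrq' := hdel (h.adj_center hr hq hrq) (by tauto) (by tauto)
  have hqy' := hdel hqy (by tauto) (by tauto)
  have hnpq : ¬ (deleteLink g p q).Adj p q := fun e => (deleteLink_adj.mp e).2 rfl
  have hnpy : ¬ (deleteLink g p q).Adj p y := fun e => hny (deleteLink_adj.mp e).1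
  have hval_y : P.b 3 ≤ P.value ((deleteLink g p q).edist p y) := by
    rw [value_of_not_adj hpy hnpy, ← benefit_coe]
    exact hP.benefit_antitone (one_le_edist hpy) (NetworkFormation.edist_le_three hpr hrq' hqy')
  have hothers : ∀ w, w ≠ q → w ≠ y →
      P.value (g.edist p w) ≤ P.value ((deleteLink g p q).edist p w) := by
    intro w hwq hwy
    rcases eq_or_ne p w with rfl | hpw
    · rw [value_self, value_self]
    by_cases hw : g.Adj p w
    · rw [value_adj hw, value_adj (hdel hw (by tauto) (by tauto))]
    · have hwC : w ∉ C := fun e => hw (h.adj_center hp e hpw)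
      obtain ⟨s, hs, hws⟩ := h.exists_center hwC
      have hps : p ≠ s := fun e => hw (e ▸ hws.symm)
      have hsq : s ≠ q := by
        rintro rfl
        exact hwy ((hyq w).mp ⟨hwC, hws.symm⟩)
      have hps' := h.adj_center hp hs hps
      rw [value_of_adj_of_adj hpw hw hps' hws.symm, value_of_adj_of_adj hpw
        (fun e => hw (deleteLink_adj.mp e).1) (hdel hps' (by tauto) (by tauto))
        (hdel hws.symm (by tauto) (by tauto))]
  have hu := hst.1 p q hadj
  have hy'' : y ∈ Finset.univ.erase q := by simpa using hqy.ne'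
  have hsum := Finset.sum_le_sum (s := (Finset.univ.erase q).erase y) fun w hw' =>
    hothers w (by simp at hw'; tauto) (by simp at hw'; tauto)
  rw [utility_eq_sum_value hγ, utility_eq_sum_value hγ,
    ← Finset.add_sum_erase _ _ (Finset.mem_univ q), ← Finset.add_sum_erase _ _ hy'',
    ← Finset.add_sum_erase _ (fun w => P.value (g.edist p w)) (Finset.mem_univ q),
    ← Finset.add_sum_erase _ (fun w => P.value (g.edist p w)) hy'', value_adj hadj,
    value_of_adj_of_adj hpy hny hadj hqy, value_of_adj_of_adj hadj.ne hnpq hpr hrq'] at hu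
  linarith

end IsKStarOn

end NetworkFormation

theorem mainTheorem3 (P : NetworkFormation.Params)
    (hb_pos : ∀ i : ℕ, 1 ≤ i → 0 < P.b i)
    (hb_decay : ∀ i : ℕ, 1 ≤ i → P.b (i + 1) < P.b i)
    (hγ_nonneg : 0 ≤ P.γ) (hγ_lt_one : P.γ < 1)
    (k : ℕ) (hk : 3 ≤ k) :
    ((∀ (n : ℕ) (g : SimpleGraph (Fin n)),
        NetworkFormation.IsKStar k g → NetworkFormation.PairwiseStable P g) →
      P.γ = 0 ∧ P.c = P.b 1 - P.b 3) ∧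
    (P.γ = 0 → P.c = P.b 1 - P.b 3 → P.b 2 - P.b 3 < P.c₀ → P.c₀ < P.b 2 - P.b 4 →
      NetworkFormation.UniqueResultingTopology P (NetworkFormation.kStarBase k)
        (fun _ g => NetworkFormation.IsKStar k g)) := by
  have hP : P.Decaying := ⟨hb_pos, hb_decay⟩
  refine ⟨fun hst => ?_, fun hγ hc hlow hupp =>
    NetworkFormation.uniqueResultingTopology_kStar hk hP hγ hc hlow hupp⟩
  have hγ := NetworkFormation.γ_eq_zero_of_stable hk hP hγ_nonneg hγ_lt_one hst
  have h := NetworkFormation.isKStarOn_kStarBase k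
  have hbase := hst _ _ (NetworkFormation.isKStar_iff.mpr ⟨_, h⟩)
  have h₁ := h.link_value_le_b_three hk hP hγ hbase
  have h₂ := h.b_three_le_link_value hk hP hγ hbase (q := ⟨0, by omega⟩)
    (by simp; omega) (NetworkFormation.leafCount_kStarBase k _ (by simp; omega))
  exact ⟨hγ, by linarith⟩
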